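/- Let $M,N\ge 0$ be integers and let $F=(\omega^{jk})_{0\le j,k<N}$, $\omega=e^{-2\pi i/N}$, be the discrete Fourier transform matrix. For $x\in\mathbb C^N$ let $P_x=|Fx|^2\in\mathbb R^N_{\ge 0}$ (componentwise) be its power spectrum. For an ordered basis $\mathbb V=(v_1,\dots,v_N)$ of $\mathbb C^N$ and $S\subset\{1,\dots,N\}$ put $\mathbb L_S=\mathrm{span}(v_i : i\in S)$ and $P_{\mathbb L_S}=\{P_x : x\in\mathbb L_S\}$. A property holds for a generic basis (resp. a generic vector of $\mathbb L_S$) if it holds on a non-empty real Zariski open subset of $GL(N,\mathbb C)$ (resp. of $\mathbb L_S$), where complex coordinates are split into their real and imaginary parts. Consider the following conditions on $\mathbb V$. - (SR1) For all $S$ with $|S|=M$ and all $x,y\in\mathbb L_S$: $P_x=P_y$ if and only if $x=ty$ for some $t\in\mathbb C$ with $|t|=1$. - (SR2) For all distinct $S_1,S_2$ with $|S_1|=|S_2|=M$: $P_{\mathbb L_{S_1}}\cap P_{\mathbb L_{S_2}}=P_{\mathbb L_{S_1}\cap\mathbb L_{S_2}}$. - (SR1g) For all $S$ with $|S|=M$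 and generic $x\in\mathbb L_S$: for every $y\in\mathbb L_S$, $P_x=P_y$ if and only if $x=ty$ for some $t\in\mathbb C$ with $|t|=1$. - (SR2g) For all distinct $S_1,S_2$ with $|S_1|=|S_2|=M$: $P_{\mathbb L_{S_1}}\cap P_{\mathbb L_{S_2}}$ is contained in a proper real-algebraic subset of $P_{\mathbb L_{S_1}}$, that is, some real-algebraic set $Z\subset\mathbb R^N$ contains $P_{\mathbb L_{S_1}}\cap P_{\mathbb L_{S_2}}$ but not $P_{\mathbb L_{S_1}}$. **Theorem.** (i) If $N>4M-3$, then (SR1) and (SR2) hold for a generic basis $\mathbb V$ of $\mathbb C^N$. (ii) If $N>2M-1$, then (SR1g) and (SR2g) hold for a generic basis $\mathbb V$ of $\mathbb C^N$. -/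

import Mathlib

open Matrix

noncomputable section

namespace PowerSpectrum

/-- Real-algebraic subsets of `ℝ^σ`: common zero loci of real polynomials. -/
def IsRealAlgebraic {σ : Type*} (Z : Set (σ → ℝ)) : Prop :=
  ∃ I : Ideal (MvPolynomial σ ℝ), Z = MvPolynomial.zeroLocus ℝ I

/-- A property holds generically on `X` (embedded in `ℝ^σ` by the real coordinates `c`) if it holds
on some non-empty Zariski open subset of `X`, that is, at all points of `X` outside some
real-algebraic set that does not contain `X`. -/
def HoldsGenerically {X σ : Type*} (c : X → σ → ℝ) (Q : X → Prop) : Prop :=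
  ∃ Z : Set (σ → ℝ), IsRealAlgebraic Z ∧ (∃ x, c x ∉ Z) ∧ ∀ x, c x ∉ Z → Q x

/-- The real coordinates (real parts and imaginary parts) of a tuple of complex numbers. -/
def realCoords {ι : Type*} (z : ι → ℂ) : ι ⊕ ι → ℝ :=
  Sum.elim (fun i => (z i).re) (fun i => (z i).im)

/-- Ordered bases of `ℂ^N`. -/
abbrev OrderedBasis (N : ℕ) : Type := Module.Basis (Fin N) ℂ (Fin N → ℂ)

/-- The real coordinates of an ordered basis of `ℂ^N`: the real and imaginary parts of all the
entries of its vectors. This identifies the ordered bases with `GL(N, ℂ)`. -/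
def basisCoords {N : ℕ} (V : OrderedBasis N) : (Fin N × Fin N) ⊕ (Fin N × Fin N) → ℝ :=
  realCoords fun p => V p.1 p.2

/-- The discrete Fourier transform matrix `(ω ^ (j k))_{0 ≤ j, k < N}`, `ω = exp (-2 π i / N)`. -/
def dftMatrix (N : ℕ) : Matrix (Fin N) (Fin N) ℂ :=
  Matrix.of fun j k => Complex.exp (-2 * Real.pi * Complex.I / N) ^ ((j : ℕ) * (k : ℕ))

/-- The power spectrum `|F x|²`, taken componentwise. -/
def powerSpectrum {N : ℕ} (x : Fin N → ℂ) : Fin N → ℝ :=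
  fun k => ‖(dftMatrix N *ᵥ x) k‖ ^ 2

/-- The span `L_S(V)` of the basis vectors with index in `S`. -/
def sparseSpan {N : ℕ} (V : OrderedBasis N) (S : Finset (Fin N)) : Submodule ℂ (Fin N → ℂ) :=
  Submodule.span ℂ (V '' (S : Set (Fin N)))

/-- Equality up to a global phase. -/
def EqUpToPhase {N : ℕ} (x y : Fin N → ℂ) : Prop :=
  ∃ t : ℂ, ‖t‖ = 1 ∧ x = t • y

/-- Condition (SR1) for `M`-sparse vectors. -/
def SR1 {N : ℕ} (M : ℕ) (V : OrderedBasis N) : Prop :=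
  ∀ S : Finset (Fin N), S.card = M → ∀ x ∈ sparseSpan V S, ∀ y ∈ sparseSpan V S,
    (powerSpectrum x = powerSpectrum y ↔ EqUpToPhase x y)

/-- Condition (SR2) for `M`-sparse vectors. -/
def SR2 {N : ℕ} (M : ℕ) (V : OrderedBasis N) : Prop :=
  ∀ S₁ S₂ : Finset (Fin N), S₁ ≠ S₂ → S₁.card = M → S₂.card = M →
    powerSpectrum '' (sparseSpan V S₁ : Set (Fin N → ℂ)) ∩
        powerSpectrum '' (sparseSpan V S₂ : Set (Fin N → ℂ)) =
      powerSpectrum '' ((sparseSpan V S₁ : Set (Fin N → ℂ)) ∩ (sparseSpan V S₂ : Set (Fin N → ℂ)))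

/-- Condition (SR1g): (SR1) for generic `x` in each `L_S(V)` with `|S| = M`. -/
def SR1g {N : ℕ} (M : ℕ) (V : OrderedBasis N) : Prop :=
  ∀ S : Finset (Fin N), S.card = M →
    HoldsGenerically (fun x : sparseSpan V S => realCoords (x : Fin N → ℂ)) fun x =>
      ∀ y ∈ sparseSpan V S,
        (powerSpectrum (x : Fin N → ℂ) = powerSpectrum y ↔ EqUpToPhase (x : Fin N → ℂ) y)

/-- Condition (SR2g): for distinct `S₁`, `S₂` of size `M`, the power spectra shared by
`L_{S₁}(V)` and `L_{S₂}(V)` lie in a proper real-algebraic subset of the set of power spectra of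
vectors of `L_{S₁}(V)`. -/
def SR2g {N : ℕ} (M : ℕ) (V : OrderedBasis N) : Prop :=
  ∀ S₁ S₂ : Finset (Fin N), S₁ ≠ S₂ → S₁.card = M → S₂.card = M →
    ∃ Z : Set (Fin N → ℝ), IsRealAlgebraic Z ∧
      powerSpectrum '' (sparseSpan V S₁ : Set (Fin N → ℂ)) ∩
        powerSpectrum '' (sparseSpan V S₂ : Set (Fin N → ℂ)) ⊆ Z ∧
      ¬ powerSpectrum '' (sparseSpan V S₁ : Set (Fin N → ℂ)) ⊆ Z

end PowerSpectrum

end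

/-!
If `|⟨a, wₖ⟩| = |⟨b, wₖ⟩|` for all `k`, where `wₖ` is the `k`-th column of `F V`, then `wₖ` is
orthogonal to `a - tₖ b` for some unimodular `tₖ`, and this vector is nonzero unless `a` and `b`
agree up to a phase. So the bad tuples are the image of a polynomial map whose parameters are the
coefficients `a` (normalized to have a coordinate `1`), the coefficients `b` (normalized to have a
real coordinate), one real number `rₖ` for each `tₖ = (rₖ + i) / (rₖ - i)`, and the column `wₖ` in
a complex hyperplane of `ℂ^N`. These are `2 (|S₁| - 1) + (2 |S₂| - 1) + N + 2 (N - 1) N` real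
parameters, fewer than the `2 N²` real coordinates of a tuple iff `2 |S₁| + 2 |S₂| < N + 3`, and a
polynomial map from fewer real parameters misses a generic point.

With `|S₁| = |S₂| = M` this gives (i). With `S₁ = {j}` it gives, for generic `V`, the assertion
about `x = v_j` alone; replacing `v_j` by a generic `x` in `L_S`, which does not change the span,
yields (SR1g). For (SR2g), the power spectrum of a vector of `L_{S₂}`, together with the `v_i` for
`i ∈ S₂`, depends on only `2 M - 1` real parameters besides these `v_i`, because a phase is lost. So
its `N` entries satisfy a polynomial relation, which the power spectrum of `v_j` for
`j ∈ S₁ \ S₂` violates.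
-/

open MvPolynomial

namespace PowerSpectrum

section PolyFun

variable {X Y σ τ ι : Type*}

/-- The real functions on `X` that are polynomials in the real coordinates `c`. -/
def polyFun (c : X → σ → ℝ) : Subalgebra ℝ (X → ℝ) :=
  Algebra.adjoin ℝ (Set.range fun s x ↦ c x s)

theorem coord_mem_polyFun (c : X → σ → ℝ) (s : σ) : (fun x ↦ c x s) ∈ polyFun c :=
  Algebra.subset_adjoin ⟨s, rfl⟩

theorem const_mem_polyFun (c : X → σ → ℝ) (r : ℝ) : (fun _ ↦ r) ∈ polyFun c :=
  (polyFun c).algebraMap_mem r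

theorem aeval_coord_apply (c : X → σ → ℝ) (p : MvPolynomial σ ℝ) (x : X) :
    aeval (fun s x ↦ c x s) p x = eval (c x) p := by
  induction p using MvPolynomial.induction_on <;> simp_all

theorem mem_polyFun_iff {c : X → σ → ℝ} {f : X → ℝ} :
    f ∈ polyFun c ↔ ∃ p : MvPolynomial σ ℝ, ∀ x, f x = eval (c x) p := by
  simp only [polyFun, Algebra.adjoin_range_eq_range_aeval, AlgHom.mem_range, funext_iff,
    aeval_coord_apply, eq_comm]

theorem comp_mem_polyFun {c : X → σ → ℝ} {c' : Y → τ → ℝ} {Φ : X → Y}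
    (hΦ : ∀ t, (fun x ↦ c' (Φ x) t) ∈ polyFun c) {f : Y → ℝ} (hf : f ∈ polyFun c') :
    f ∘ Φ ∈ polyFun c := by
  induction hf using Algebra.adjoin_induction with
  | mem f hf => obtain ⟨t, rfl⟩ := hf; exact hΦ t
  | algebraMap r => exact const_mem_polyFun c r
  | add f g _ _ hf hg => exact add_mem hf hg
  | mul f g _ _ hf hg => exact mul_mem hf hg

theorem not_algebraicIndependent_of_mem_polyFun [Fintype σ] [Fintype τ] {c : X → σ → ℝ}
    {f : τ → X → ℝ} (hf : ∀ t, f t ∈ polyFun c) (hcard : Fintype.card σ < Fintype.card τ) :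
    ¬ AlgebraicIndependent ℝ f := by
  intro h
  choose p hp using fun t ↦ mem_polyFun_iff.1 (hf t)
  have hpf : aeval (fun s x ↦ c x s) ∘ p = f := by
    ext t x
    rw [hp t x, Function.comp_apply, aeval_coord_apply]
  have hle := (AlgebraicIndependent.of_comp _ (hpf ▸ h)).lift_cardinalMk_le_trdeg
  rw [trdeg_of_isDomain, Cardinal.mk_fintype, Cardinal.mk_fintype] at hle
  simp only [Cardinal.lift_natCast, Nat.cast_le] at hle
  exact hle.not_gt hcard

/-- The complex functions on `X` whose real and imaginary parts are polynomials in the real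
coordinates `c`. -/
def complexPolyFun (c : X → σ → ℝ) : Subalgebra ℂ (X → ℂ) where
  carrier := {f | (fun x ↦ (f x).re) ∈ polyFun c ∧ (fun x ↦ (f x).im) ∈ polyFun c}
  mul_mem' hf hg :=
    ⟨sub_mem (mul_mem hf.1 hg.1) (mul_mem hf.2 hg.2),
      add_mem (mul_mem hf.1 hg.2) (mul_mem hf.2 hg.1)⟩
  add_mem' hf hg := ⟨add_mem hf.1 hg.1, add_mem hf.2 hg.2⟩
  algebraMap_mem' z := ⟨const_mem_polyFun c z.re, const_mem_polyFun c z.im⟩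

theorem const_mem_complexPolyFun (c : X → σ → ℝ) (z : ℂ) : (fun _ ↦ z) ∈ complexPolyFun c :=
  (complexPolyFun c).algebraMap_mem z

theorem ofReal_mem_complexPolyFun {c : X → σ → ℝ} {f : X → ℝ} (hf : f ∈ polyFun c) :
    (fun x ↦ (f x : ℂ)) ∈ complexPolyFun c :=
  ⟨hf, (polyFun c).zero_mem⟩

theorem norm_sq_mem_polyFun {c : X → σ → ℝ} {f : X → ℂ} (hf : f ∈ complexPolyFun c) :
    (fun x ↦ ‖f x‖ ^ 2) ∈ polyFun c := by
  simp only [Complex.sq_norm, Complex.normSq_apply]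
  exact add_mem (mul_mem hf.1 hf.1) (mul_mem hf.2 hf.2)

theorem coord_mem_complexPolyFun (i : ι) : (fun z : ι → ℂ ↦ z i) ∈ complexPolyFun realCoords :=
  ⟨coord_mem_polyFun realCoords (.inl i), coord_mem_polyFun realCoords (.inr i)⟩

theorem realCoords_mem_polyFun {c : X → σ → ℝ} {z : X → ι → ℂ}
    (hz : ∀ i, (fun x ↦ z x i) ∈ complexPolyFun c) (t : ι ⊕ ι) :
    (fun x ↦ realCoords (z x) t) ∈ polyFun c :=
  match t with
  | .inl i => (hz i).1
  | .inr i => (hz i).2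

theorem sum_mul_mem_complexPolyFun {c : X → σ → ℝ} (s : Finset ι) {f g : ι → X → ℂ}
    (hf : ∀ i ∈ s, f i ∈ complexPolyFun c) (hg : ∀ i ∈ s, g i ∈ complexPolyFun c) :
    (fun x ↦ ∑ i ∈ s, f i x * g i x) ∈ complexPolyFun c := by
  have : (fun x ↦ ∑ i ∈ s, f i x * g i x) = ∑ i ∈ s, f i * g i := by
    ext x
    simp
  rw [this]
  exact sum_mem fun i hi ↦ mul_mem (hf i hi) (hg i hi)

theorem linearMap_apply_mem_complexPolyFun [Finite ι] {c : X → σ → ℝ} {z : X → ι → ℂ}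
    (hz : ∀ i, (fun x ↦ z x i) ∈ complexPolyFun c) (φ : (ι → ℂ) →ₗ[ℂ] ℂ) :
    (fun x ↦ φ (z x)) ∈ complexPolyFun c := by
  classical
  have := Fintype.ofFinite ι
  rw [show (fun x ↦ φ (z x)) = fun x ↦ ∑ i, z x i * φ _ from
    funext fun x ↦ φ.pi_apply_eq_sum_univ (z x)]
  exact sum_mul_mem_complexPolyFun _ (fun i _ ↦ hz i) fun _ _ ↦ const_mem_complexPolyFun c _

end PolyFun

section Generic

variable {X Y σ τ : Type*} {c : X → σ → ℝ} {c' : Y → τ → ℝ}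

/-- The coordinates `c` map `X` onto a Zariski dense subset of `ℝ^σ`: they satisfy no nontrivial
polynomial relation on `X`. -/
def ZariskiDense (c : X → σ → ℝ) : Prop :=
  AlgebraicIndependent ℝ fun s x ↦ c x s

theorem zariskiDense_iff : ZariskiDense c ↔ ∀ p, (∀ x, eval (c x) p = 0) → p = 0 := by
  simp only [ZariskiDense, algebraicIndependent_iff, funext_iff, aeval_coord_apply, Pi.zero_apply]

theorem zariskiDense_of_pi_subset_range {I : σ → Set ℝ} (hI : ∀ s, (I s).Infinite)
    (hc : Set.univ.pi I ⊆ Set.range c) : ZariskiDense c := by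
  refine zariskiDense_iff.2 fun p hp ↦ MvPolynomial.funext_set I hI fun z hz ↦ ?_
  obtain ⟨x, rfl⟩ := hc hz
  rw [hp, map_zero]

theorem zariskiDense_of_surjective (hc : Function.Surjective c) : ZariskiDense c :=
  zariskiDense_of_pi_subset_range (fun _ ↦ Set.infinite_univ) (hc.range_eq ▸ Set.subset_univ _)

theorem ZariskiDense.isDomain_polyFun (hc : ZariskiDense c) : IsDomain (polyFun c) :=
  hc.aevalEquiv.symm.toMulEquiv.isDomain _

theorem isRealAlgebraic_setOf_eval_eq_zero (p : MvPolynomial σ ℝ) :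
    IsRealAlgebraic {z | eval z p = 0} :=
  ⟨Ideal.span {p}, by ext; simp [zeroLocus_span, aeval_eq_eval]⟩

theorem holdsGenerically_iff {Q : X → Prop} :
    HoldsGenerically c Q ↔ ∃ f ∈ polyFun c, f ≠ 0 ∧ ∀ x, f x ≠ 0 → Q x := by
  constructor
  · rintro ⟨_, ⟨I, rfl⟩, ⟨x₀, hx₀⟩, hQ⟩
    obtain ⟨p, hpI, hp⟩ : ∃ p ∈ I, eval (c x₀) p ≠ 0 := by
      simpa [mem_zeroLocus_iff, aeval_eq_eval] using hx₀
    refine ⟨fun x ↦ eval (c x) p, mem_polyFun_iff.2 ⟨p, fun _ ↦ rfl⟩, fun h ↦ hp (congrFun h x₀),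
      fun x hx ↦ hQ x fun hxI ↦ hx ?_⟩
    simpa [aeval_eq_eval] using hxI p hpI
  · rintro ⟨f, hf, hf₀, hQ⟩
    obtain ⟨p, hp⟩ := mem_polyFun_iff.1 hf
    obtain ⟨x₀, hx₀⟩ := Function.ne_iff.1 hf₀
    exact ⟨_, isRealAlgebraic_setOf_eval_eq_zero p, ⟨x₀, (hp x₀).symm.trans_ne hx₀⟩,
      fun x hx ↦ hQ x ((hp x).trans_ne hx)⟩

theorem holdsGenerically_of_forall [Nonempty X] {Q : X → Prop} (h : ∀ x, Q x) :
    HoldsGenerically c Q :=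
  holdsGenerically_iff.2 ⟨1, one_mem _, one_ne_zero, fun x _ ↦ h x⟩

theorem HoldsGenerically.mono {P Q : X → Prop} (h : HoldsGenerically c P) (hPQ : ∀ x, P x → Q x) :
    HoldsGenerically c Q := by
  obtain ⟨Z, hZ, hne, hP⟩ := h
  exact ⟨Z, hZ, hne, fun x hx ↦ hPQ x (hP x hx)⟩

theorem HoldsGenerically.exists {Q : X → Prop} (h : HoldsGenerically c Q) : ∃ x, Q x := by
  obtain ⟨Z, -, ⟨x, hx⟩, hQ⟩ := h
  exact ⟨x, hQ x hx⟩

theorem holdsGenerically_forall {α : Sort*} [Finite α] (hc : ZariskiDense c)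
    {Q : α → X → Prop} (h : ∀ a, HoldsGenerically c (Q a)) :
    HoldsGenerically c fun x ↦ ∀ a, Q a x := by
  have := hc.isDomain_polyFun
  have := Fintype.ofFinite (PLift α)
  choose f hf hf₀ hQ using fun a ↦ holdsGenerically_iff.1 (h a)
  let g (a : PLift α) : polyFun c := ⟨f a.down, hf a.down⟩
  have hg : ∏ a, g a ≠ 0 := Finset.prod_ne_zero_iff.2 fun a _ ↦ Subtype.coe_ne_coe.1 (hf₀ a.down)
  refine holdsGenerically_iff.2 ⟨_, (∏ a, g a).2, Subtype.coe_ne_coe.2 hg, fun x hx a ↦ ?_⟩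
  simp only [SubmonoidClass.coe_finsetProd, Finset.prod_apply] at hx
  exact hQ a x (Finset.prod_ne_zero_iff.1 hx ⟨a⟩ (Finset.mem_univ _))

theorem HoldsGenerically.and {P Q : X → Prop} (hP : HoldsGenerically c P)
    (hc : ZariskiDense c) (hQ : HoldsGenerically c Q) :
    HoldsGenerically c fun x ↦ P x ∧ Q x :=
  (holdsGenerically_forall (Q := fun b : Bool ↦ cond b P Q) hc (Bool.rec hQ hP)).mono
    fun _ h ↦ ⟨h true, h false⟩

theorem HoldsGenerically.comp {Q : Y → Prop} (h : HoldsGenerically c' Q) {Φ : X → Y}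
    (hΦ : ∀ t, (fun x ↦ c' (Φ x) t) ∈ polyFun c) (hdense : ZariskiDense (c' ∘ Φ)) :
    HoldsGenerically c fun x ↦ Q (Φ x) := by
  obtain ⟨f, hf, hf₀, hQ⟩ := holdsGenerically_iff.1 h
  refine holdsGenerically_iff.2 ⟨f ∘ Φ, comp_mem_polyFun hΦ hf, fun h₀ ↦ hf₀ ?_, fun x ↦ hQ (Φ x)⟩
  obtain ⟨p, hp⟩ := mem_polyFun_iff.1 hf
  have hp₀ : p = 0 := zariskiDense_iff.1 hdense p fun x ↦ (hp (Φ x)).symm.trans (congrFun h₀ x)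
  ext y
  rw [hp, hp₀, map_zero, Pi.zero_apply]

theorem exists_polyFun_comp_eq_zero [Fintype σ] [Fintype τ] (hc' : ZariskiDense c')
    {Φ : X → Y} (hΦ : ∀ t, (fun x ↦ c' (Φ x) t) ∈ polyFun c)
    (hcard : Fintype.card σ < Fintype.card τ) :
    ∃ f ∈ polyFun c', f ≠ 0 ∧ ∀ x, f (Φ x) = 0 := by
  have hdep := not_algebraicIndependent_of_mem_polyFun hΦ hcard
  simp only [algebraicIndependent_iff, not_forall] at hdep
  obtain ⟨p, hp, hp₀⟩ := hdep
  refine ⟨aeval (fun t y ↦ c' y t) p, ?_, fun h ↦ hp₀ ?_, fun x ↦ ?_⟩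
  · exact mem_polyFun_iff.2 ⟨p, aeval_coord_apply c' p⟩
  · exact algebraicIndependent_iff.1 hc' p h
  · rw [aeval_coord_apply, ← aeval_coord_apply (fun x ↦ c' (Φ x)), hp, Pi.zero_apply]

theorem holdsGenerically_notMem_range [Fintype σ] [Fintype τ] (hc' : ZariskiDense c')
    {Φ : X → Y} (hΦ : ∀ t, (fun x ↦ c' (Φ x) t) ∈ polyFun c)
    (hcard : Fintype.card σ < Fintype.card τ) :
    HoldsGenerically c' fun y ↦ y ∉ Set.range Φ := by
  obtain ⟨f, hf, hf₀, hΦf⟩ := exists_polyFun_comp_eq_zero hc' hΦ hcard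
  refine holdsGenerically_iff.2 ⟨f, hf, hf₀, ?_⟩
  rintro _ hy ⟨x, rfl⟩
  exact hy (hΦf x)

end Generic

section Tuples

variable {ι κ : Type*}

/-- The real and imaginary parts of all the entries of a tuple of vectors. -/
def tupleCoords (v : ι → κ → ℂ) : (ι × κ) ⊕ (ι × κ) → ℝ :=
  realCoords fun q ↦ v q.1 q.2

theorem realCoords_surjective : Function.Surjective (realCoords : (ι → ℂ) → ι ⊕ ι → ℝ) :=
  fun r ↦ ⟨fun i ↦ ⟨r (.inl i), r (.inr i)⟩, by ext (i | i) <;> rfl⟩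

theorem tupleCoords_surjective :
    Function.Surjective (tupleCoords : (ι → κ → ℂ) → (ι × κ) ⊕ (ι × κ) → ℝ) :=
  realCoords_surjective.comp (Equiv.curry ι κ ℂ).symm.surjective

theorem zariskiDense_tupleCoords :
    ZariskiDense (tupleCoords : (ι → κ → ℂ) → (ι × κ) ⊕ (ι × κ) → ℝ) :=
  zariskiDense_of_surjective tupleCoords_surjective

theorem entry_mem_complexPolyFun (i : ι) (k : κ) :
    (fun v : ι → κ → ℂ ↦ v i k) ∈ complexPolyFun tupleCoords :=
  ⟨coord_mem_polyFun tupleCoords (.inl (i, k)), coord_mem_polyFun tupleCoords (.inr (i, k))⟩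

theorem holdsGenerically_linearIndependent [Finite ι] :
    HoldsGenerically tupleCoords fun v : ι → ι → ℂ ↦ LinearIndependent ℂ v := by
  classical
  have := Fintype.ofFinite ι
  have hdet : (fun v : ι → ι → ℂ ↦ (of v).det) ∈ complexPolyFun tupleCoords := by
    have : (fun v : ι → ι → ℂ ↦ (of v).det) =
        ∑ π : Equiv.Perm ι, Equiv.Perm.sign π • ∏ i, fun v ↦ v (π i) i := by
      ext v
      simp [det_apply]
    rw [this]
    exact sum_mem fun π _ ↦ zsmul_mem (prod_mem fun i _ ↦ entry_mem_complexPolyFun (π i) i) _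
  refine holdsGenerically_iff.2 ⟨_, norm_sq_mem_polyFun hdet, fun h ↦ ?_, fun v hv ↦ ?_⟩
  · simpa using congrFun h (of.symm 1)
  · refine linearIndependent_rows_of_det_ne_zero (A := of v) fun h ↦ hv ?_
    simp [h]

theorem zariskiDense_basisCoords (N : ℕ) :
    ZariskiDense (basisCoords : OrderedBasis N → (Fin N × Fin N) ⊕ (Fin N × Fin N) → ℝ) := by
  refine zariskiDense_iff.2 fun p hp ↦ by_contra fun hp₀ ↦ ?_
  have hgen : HoldsGenerically tupleCoords fun v : Fin N → Fin N → ℂ ↦ eval (tupleCoords v) p ≠ 0 :=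
    holdsGenerically_iff.2 ⟨_, mem_polyFun_iff.2 ⟨p, fun _ ↦ rfl⟩,
      fun h ↦ hp₀ (zariskiDense_iff.1 zariskiDense_tupleCoords p (congrFun h)), fun _ h ↦ h⟩
  obtain ⟨v, hvp, hv⟩ :=
    (hgen.and zariskiDense_tupleCoords holdsGenerically_linearIndependent).exists
  let V : OrderedBasis N := .mk hv (hv.span_eq_top_of_card_eq_finrank' (by simp)).ge
  have hV : ⇑V = v := Module.Basis.coe_mk ..
  exact hvp (hV ▸ hp V)

theorem HoldsGenerically.of_tupleCoords {N : ℕ} {Q : (Fin N → Fin N → ℂ) → Prop}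
    (h : HoldsGenerically tupleCoords Q) :
    HoldsGenerically basisCoords fun V : OrderedBasis N ↦ Q V :=
  h.comp (coord_mem_polyFun basisCoords) (zariskiDense_basisCoords N)

end Tuples

section Collision

variable {ι κ : Type*}

theorem exists_eq_mul_of_norm_eq {z w : ℂ} (h : ‖z‖ = ‖w‖) : ∃ t : ℂ, ‖t‖ = 1 ∧ z = t * w := by
  rcases eq_or_ne w 0 with rfl | hw
  · exact ⟨1, norm_one, by simpa using h⟩
  · exact ⟨z / w, by rw [norm_div, h, div_self (norm_ne_zero_iff.2 hw)],
      (div_mul_cancel₀ z hw).symm⟩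

theorem exists_add_mul_I_eq_mul_of_norm_eq_one {t : ℂ} (ht : ‖t‖ = 1) :
    ∃ (r : ℝ) (d : Fin 2), (r - d * Complex.I : ℂ) ≠ 0 ∧
      (r + d * Complex.I : ℂ) = t * (r - d * Complex.I) := by
  rcases eq_or_ne t 1 with rfl | ht₁
  · exact ⟨1, 0, by simp⟩
  have hsq : t.re * t.re + t.im * t.im = 1 := by
    rw [← Complex.normSq_apply, ← Complex.sq_norm, ht, one_pow]
  have hre : 1 - t.re ≠ 0 := fun h ↦ ht₁ <| Complex.ext (by rw [Complex.one_re]; linarith) <| by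
    have : t.re = 1 := by linarith
    simpa [this] using hsq
  obtain ⟨r, hr⟩ : ∃ r, r * (1 - t.re) = t.im := ⟨t.im / (1 - t.re), div_mul_cancel₀ _ hre⟩
  refine ⟨r, 1, fun h ↦ ?_, Complex.ext ?_ ?_⟩
  · simpa using congrArg Complex.im h
  · simp only [Fin.isValue, Fin.coe_ofNat_eq_mod, Nat.mod_succ, Nat.cast_one, one_mul,
      Complex.add_re, Complex.ofReal_re, Complex.I_re, add_zero, Complex.mul_re, Complex.sub_re,
      sub_zero, Complex.sub_im, Complex.ofReal_im, Complex.I_im, zero_sub, mul_neg, mul_one,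
      sub_neg_eq_add]
    linarith
  · have him : t.im * r = 1 + t.re := mul_right_cancel₀ hre (by linear_combination t.im * hr + hsq)
    simp [him]

theorem exists_eq_smul_sub_of_dotProduct_eq_zero [Fintype ι] [DecidableEq ι] {c w : ι → ℂ}
    (hcw : c ⬝ᵥ w = 0) {i : ι} (hi : c i ≠ 0) :
    ∃ μ : ι → ℂ, μ i = 0 ∧ w = c i • μ - (c ⬝ᵥ μ) • Pi.single i 1 := by
  refine ⟨(c i)⁻¹ • w - ((c i)⁻¹ * w i) • Pi.single i 1, by simp, ?_⟩
  simp only [dotProduct_sub, dotProduct_smul, hcw, dotProduct_single]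
  ext j
  simp only [smul_eq_mul, mul_zero, mul_one, zero_sub, neg_smul, Pi.sub_apply, Pi.smul_apply,
    Pi.neg_apply, sub_neg_eq_add]
  field_simp
  ring

theorem mem_span_image_iff_exists_vecMul [Fintype ι] {v : ι → κ → ℂ} {S : Finset ι} {x : κ → ℂ} :
    x ∈ Submodule.span ℂ (v '' S) ↔ ∃ a : ι → ℂ, (∀ i ∉ S, a i = 0) ∧ a ᵥ* of v = x := by
  classical
  rw [Submodule.mem_span_image_finset_iff_exists_fun']
  constructor
  · rintro ⟨a, rfl⟩
    refine ⟨fun i ↦ if i ∈ S then a i else 0, fun i hi ↦ if_neg hi, ?_⟩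
    simp only [vecMul_eq_sum, ite_smul, zero_smul, Finset.sum_ite_mem, Finset.univ_inter]
    rfl
  · rintro ⟨a, ha, rfl⟩
    refine ⟨a, ?_⟩
    rw [vecMul_eq_sum]
    exact Finset.sum_subset S.subset_univ fun i _ hi ↦ by simp [ha i hi]

/-- The parameters of a tuple `v` for which some `x = ∑ i ∈ S₁, a i • v i` and
`y = ∑ j ∈ S₂, b j • v j` satisfy `|x k| = |y k|` for all `k` without being equal up to a phase.
The coefficients are normalized at `i₀` and `j₀`. The unimodular `t` with `x k = t * y k` is encoded
by `r k` as in `exists_add_mul_I_eq_mul_of_norm_eq_one`, and `μ k` parametrizes the hyperplane that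
contains the `k`-th column of `v`; the coordinate `p k` is solved for. -/
structure CollisionParam (S₁ S₂ : Finset ι) (i₀ j₀ : ι) (p : κ → ι) where
  a : ι → ℂ
  b : ι → ℂ
  r : κ → ℝ
  μ : κ → ι → ℂ
  a_eq_one : a i₀ = 1
  a_eq_zero : ∀ i ∉ S₁, a i = 0
  im_b_eq_zero : (b j₀).im = 0
  b_eq_zero : ∀ j ∉ S₂, b j = 0
  μ_eq_zero : ∀ k, μ k (p k) = 0

namespace CollisionParam

variable [DecidableEq ι] {S₁ S₂ : Finset ι} {i₀ j₀ : ι} {p : κ → ι}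

/-- The index set of the real coordinates of a `CollisionParam`. -/
abbrev Index (S₁ S₂ : Finset ι) (i₀ j₀ : ι) (p : κ → ι) : Type _ :=
  ((S₁.erase i₀ ⊕ S₁.erase i₀) ⊕ (S₂ ⊕ S₂.erase j₀)) ⊕
    (κ ⊕ ((Σ k, {j // j ≠ p k}) ⊕ (Σ k, {j // j ≠ p k})))

/-- The real coordinates of a `CollisionParam` that are not fixed by its constraints. -/
def coords (θ : CollisionParam S₁ S₂ i₀ j₀ p) : Index S₁ S₂ i₀ j₀ p → ℝ :=
  Sum.elim
    (Sum.elim (realCoords fun i ↦ θ.a i) (Sum.elim (fun j ↦ (θ.b j).re) (fun j ↦ (θ.b j).im)))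
    (Sum.elim θ.r (realCoords fun q ↦ θ.μ q.1 q.2))

theorem card_index_lt [Fintype ι] [Fintype κ] (hi₀ : i₀ ∈ S₁) (hj₀ : j₀ ∈ S₂)
    (hcard : 2 * S₁.card + 2 * S₂.card < Fintype.card κ + 3) :
    Fintype.card (Index S₁ S₂ i₀ j₀ p) < Fintype.card ((ι × κ) ⊕ (ι × κ)) := by
  obtain ⟨n, hn⟩ := Nat.exists_eq_add_one.2 (Fintype.card_pos_iff.2 ⟨i₀⟩)
  have h₁ := Finset.card_pos.2 ⟨i₀, hi₀⟩
  have h₂ := Finset.card_pos.2 ⟨j₀, hj₀⟩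
  simp only [Fintype.card_sum, Fintype.card_prod, Fintype.card_sigma, Fintype.card_coe,
    Finset.card_erase_of_mem hi₀, Finset.card_erase_of_mem hj₀, Fintype.card_subtype_compl,
    Fintype.card_unique, Finset.sum_const, Finset.card_univ, smul_eq_mul, hn, add_mul,
    Nat.add_sub_cancel, mul_comm n]
  omega

theorem a_mem (i : ι) :
    (fun θ : CollisionParam S₁ S₂ i₀ j₀ p ↦ θ.a i) ∈ complexPolyFun coords := by
  by_cases hi : i ∈ S₁.erase i₀
  · exact ⟨coord_mem_polyFun coords (.inl (.inl (.inl ⟨i, hi⟩))),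
      coord_mem_polyFun coords (.inl (.inl (.inr ⟨i, hi⟩)))⟩
  · rcases eq_or_ne i i₀ with rfl | hne
    · simpa only [a_eq_one] using const_mem_complexPolyFun coords 1
    · have ha (θ : CollisionParam S₁ S₂ i₀ j₀ p) : θ.a i = 0 :=
        θ.a_eq_zero i fun h ↦ hi (Finset.mem_erase_of_ne_of_mem hne h)
      simpa only [ha] using const_mem_complexPolyFun coords 0

theorem b_mem (j : ι) :
    (fun θ : CollisionParam S₁ S₂ i₀ j₀ p ↦ θ.b j) ∈ complexPolyFun coords := by
  by_cases hj : j ∈ S₂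
  · refine ⟨coord_mem_polyFun coords (.inl (.inr (.inl ⟨j, hj⟩))), ?_⟩
    rcases eq_or_ne j j₀ with rfl | hne
    · simpa only [im_b_eq_zero] using const_mem_polyFun coords 0
    · exact coord_mem_polyFun coords (.inl (.inr (.inr ⟨j, Finset.mem_erase_of_ne_of_mem hne hj⟩)))
  · have hb (θ : CollisionParam S₁ S₂ i₀ j₀ p) : θ.b j = 0 := θ.b_eq_zero j hj
    simpa only [hb] using const_mem_complexPolyFun coords 0

theorem μ_mem (k : κ) (j : ι) :
    (fun θ : CollisionParam S₁ S₂ i₀ j₀ p ↦ θ.μ k j) ∈ complexPolyFun coords := by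
  rcases eq_or_ne j (p k) with rfl | hne
  · simpa only [μ_eq_zero] using const_mem_complexPolyFun coords 0
  · exact ⟨coord_mem_polyFun coords (.inr (.inr (.inl ⟨k, j, hne⟩))),
      coord_mem_polyFun coords (.inr (.inr (.inr ⟨k, j, hne⟩)))⟩

/-- The normal vector of the hyperplane that contains the `k`-th column of the parametrized tuple.
The choice `d k = 0` occurs only for the phase `1`, which `r + i` over `r - i` does not attain. -/
def normal (d : κ → Fin 2) (θ : CollisionParam S₁ S₂ i₀ j₀ p) (k : κ) : ι → ℂ :=
  (θ.r k - d k * Complex.I : ℂ) • θ.a - (θ.r k + d k * Complex.I : ℂ) • θ.b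

variable [Fintype ι]

/-- The tuple with the given parameters: its `k`-th column lies in the hyperplane orthogonal to
`normal d θ k`. -/
def tuple (d : κ → Fin 2) (θ : CollisionParam S₁ S₂ i₀ j₀ p) (j : ι) (k : κ) : ℂ :=
  (θ.normal d k (p k) • θ.μ k - (θ.normal d k ⬝ᵥ θ.μ k) • Pi.single (p k) 1 : ι → ℂ) j

theorem tupleCoords_tuple_mem (d : κ → Fin 2) (t : (ι × κ) ⊕ (ι × κ)) :
    (fun θ : CollisionParam S₁ S₂ i₀ j₀ p ↦ tupleCoords (θ.tuple d) t) ∈ polyFun coords := by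
  have hr (k : κ) :
      (fun θ : CollisionParam S₁ S₂ i₀ j₀ p ↦ (θ.r k : ℂ)) ∈ complexPolyFun coords :=
    ofReal_mem_complexPolyFun (coord_mem_polyFun coords (.inr (.inl k)))
  have hd (k : κ) := const_mem_complexPolyFun (coords (S₁ := S₁) (S₂ := S₂) (i₀ := i₀) (j₀ := j₀)
    (p := p)) (d k * Complex.I)
  have hnormal (k : κ) (j : ι) :
      (fun θ : CollisionParam S₁ S₂ i₀ j₀ p ↦ θ.normal d k j) ∈ complexPolyFun coords :=
    sub_mem (mul_mem (sub_mem (hr k) (hd k)) (a_mem j)) (mul_mem (add_mem (hr k) (hd k)) (b_mem j))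
  refine realCoords_mem_polyFun (fun q ↦ ?_) t
  exact sub_mem (mul_mem (hnormal _ _) (μ_mem _ _)) <| mul_mem
    (sum_mul_mem_complexPolyFun _ (fun j _ ↦ hnormal _ j) fun j _ ↦ μ_mem _ j)
    (const_mem_complexPolyFun _ _)

theorem exists_mem_range_tuple {v : ι → κ → ℂ} {a b : ι → ℂ} (ha₁ : a i₀ = 1)
    (ha : ∀ i ∉ S₁, a i = 0) (hb₀ : (b j₀).im = 0) (hb : ∀ j ∉ S₂, b j = 0)
    (hnorm : ∀ k, ‖(a ᵥ* of v) k‖ = ‖(b ᵥ* of v) k‖)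
    (hab : ∀ t : ℂ, ‖t‖ = 1 → a ≠ t • b) :
    ∃ (p : κ → ι) (d : κ → Fin 2),
      v ∈ Set.range (tuple d : CollisionParam S₁ S₂ i₀ j₀ p → ι → κ → ℂ) := by
  have hphase (k : κ) : ∃ (r : ℝ) (d : Fin 2) (p : ι),
      ((r - d * Complex.I : ℂ) • a - (r + d * Complex.I : ℂ) • b) p ≠ 0 ∧
      ((r - d * Complex.I : ℂ) • a - (r + d * Complex.I : ℂ) • b) ⬝ᵥ (fun i ↦ v i k) = 0 := by
    obtain ⟨t, ht, hxy⟩ := exists_eq_mul_of_norm_eq (hnorm k)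
    obtain ⟨r, d, hu, hrd⟩ := exists_add_mul_I_eq_mul_of_norm_eq_one ht
    obtain ⟨p, hp⟩ := Function.ne_iff.1 (hab t ht)
    refine ⟨r, d, p, ?_, ?_⟩
    · have : (r - d * Complex.I : ℂ) * (a p - t * b p) ≠ 0 := mul_ne_zero hu (sub_ne_zero.2 hp)
      convert this using 1
      simp only [hrd, Pi.sub_apply, Pi.smul_apply, smul_eq_mul]
      ring
    · rw [sub_dotProduct, smul_dotProduct, smul_dotProduct]
      change _ • (a ᵥ* of v) k - _ • (b ᵥ* of v) k = 0
      rw [hxy, hrd, smul_eq_mul, smul_eq_mul]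
      ring
  choose r d p hp hperp using hphase
  choose μ hμ hv using fun k ↦ exists_eq_smul_sub_of_dotProduct_eq_zero (hperp k) (hp k)
  exact ⟨p, d, ⟨a, b, r, μ, ha₁, ha, hb₀, hb, hμ⟩, funext₂ fun j k ↦ (congrFun (hv k) j).symm⟩

theorem holdsGenerically_forall_notMem_range_tuple [Fintype κ] (hj₀ : j₀ ∈ S₂)
    (hcard : 2 * S₁.card + 2 * S₂.card < Fintype.card κ + 3) :
    HoldsGenerically tupleCoords fun v : ι → κ → ℂ ↦ ∀ (i₀ : S₁) (p : κ → ι) (d : κ → Fin 2),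
      v ∉ Set.range (tuple d : CollisionParam S₁ S₂ i₀ j₀ p → ι → κ → ℂ) := by
  refine holdsGenerically_forall zariskiDense_tupleCoords fun i₀ ↦ ?_
  refine holdsGenerically_forall zariskiDense_tupleCoords fun p ↦ ?_
  refine holdsGenerically_forall zariskiDense_tupleCoords fun d ↦ ?_
  exact holdsGenerically_notMem_range zariskiDense_tupleCoords (tupleCoords_tuple_mem d)
    (card_index_lt i₀.2 hj₀ hcard)

end CollisionParam

theorem holdsGenerically_eq_smul_of_norm_eq [Finite ι] [Fintype κ] {S₁ S₂ : Finset ι}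
    (hcard : 2 * S₁.card + 2 * S₂.card < Fintype.card κ + 3) :
    HoldsGenerically tupleCoords fun v : ι → κ → ℂ ↦
      ∀ x ∈ Submodule.span ℂ (v '' S₁), x ≠ 0 → ∀ y ∈ Submodule.span ℂ (v '' S₂),
        (∀ k, ‖x k‖ = ‖y k‖) → ∃ t : ℂ, ‖t‖ = 1 ∧ x = t • y := by
  classical
  have := Fintype.ofFinite ι
  rcases S₂.eq_empty_or_nonempty with rfl | ⟨j₀, hj₀⟩
  · refine holdsGenerically_of_forall fun v x _ hx₀ y hy hxy ↦ absurd (funext fun k ↦ ?_) hx₀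
    have hy₀ : y = 0 := by simpa using hy
    simpa [hy₀] using hxy k
  refine (CollisionParam.holdsGenerically_forall_notMem_range_tuple hj₀ hcard).mono
    fun v hv x hx hx₀ y hy hxy ↦ ?_
  obtain ⟨a, ha, rfl⟩ := mem_span_image_iff_exists_vecMul.1 hx
  obtain ⟨b, hb, rfl⟩ := mem_span_image_iff_exists_vecMul.1 hy
  obtain ⟨i₀, hai₀⟩ : ∃ i, a i ≠ 0 := Function.ne_iff.1 fun h ↦ hx₀ (h ▸ zero_vecMul _)
  have hi₀ : i₀ ∈ S₁ := by_contra fun h ↦ hai₀ (ha i₀ h)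
  by_contra! hphase
  have hab (t : ℂ) (ht : ‖t‖ = 1) : a ≠ t • b := fun h ↦
    hphase t ht (by rw [h, smul_vecMul])
  -- Scaling `x` and `y` by `(a i₀)⁻¹`, and then `y` by the phase `s`, normalizes the coefficients.
  obtain ⟨s, hs, hsb⟩ := Complex.exists_norm_eq_mul_self ((a i₀)⁻¹ * b j₀)
  obtain ⟨p, d, hmem⟩ := CollisionParam.exists_mem_range_tuple (v := v) (i₀ := i₀) (j₀ := j₀)
    (a := (a i₀)⁻¹ • a) (b := (a i₀)⁻¹ • s • b) (inv_mul_cancel₀ hai₀)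
    (fun i hi ↦ by simp [ha i hi])
    (by simp [mul_left_comm _ s, ← hsb]) (fun j hj ↦ by simp [hb j hj])
    (fun k ↦ by simp [smul_vecMul, hs, hxy k]) fun t ht h ↦ by
      rw [smul_comm t] at h
      exact hab (t * s) (by simp [ht, hs])
        ((smul_right_injective _ (inv_ne_zero hai₀) h).trans (smul_smul t s b))
  exact hv ⟨i₀, hi₀⟩ p d hmem

end Collision

section GenericVector

variable {ι κ : Type*} [DecidableEq ι]

theorem HoldsGenerically.exists_update {Q : (ι → κ → ℂ) → Prop}
    (h : HoldsGenerically tupleCoords Q) (j : ι) :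
    HoldsGenerically tupleCoords fun v ↦ ∃ g ∈ polyFun (realCoords : (κ → ℂ) → κ ⊕ κ → ℝ),
      g (v j) ≠ 0 ∧ ∀ u, g u ≠ 0 → Q (Function.update v j u) := by
  obtain ⟨f, hf, hf₀, hQ⟩ := holdsGenerically_iff.1 h
  refine holdsGenerically_iff.2 ⟨f, hf, hf₀, fun v hv ↦
    ⟨f ∘ Function.update v j, comp_mem_polyFun (fun t ↦ ?_) hf, ?_, fun u ↦ hQ _⟩⟩
  · refine realCoords_mem_polyFun (z := fun u q ↦ Function.update v j u q.1 q.2) (fun q ↦ ?_) t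
    rcases eq_or_ne q.1 j with hq | hq
    · simpa only [hq, Function.update_self] using coord_mem_complexPolyFun q.2
    · simpa only [Function.update_of_ne hq] using const_mem_complexPolyFun realCoords (v q.1 q.2)
  · rwa [Function.comp_apply, Function.update_eq_self]

theorem span_image_le_span_update_image {K E : Type*} [DivisionRing K] [AddCommGroup E] [Module K E]
    (V : Module.Basis ι K E) {S : Set ι} {j : ι} {x : E} (hx : x ∈ Submodule.span K (V '' S))
    (hxj : V.repr x j ≠ 0) :
    Submodule.span K (V '' S) ≤ Submodule.span K (Function.update V j x '' S) := by
  have hxj' : j ∈ (V.repr x).support := Finsupp.mem_support_iff.2 hxj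
  have hrest : Function.update V j x '' (S \ {j}) = V '' (S \ {j}) :=
    Set.image_congr fun i hi ↦ Function.update_of_ne hi.2 x V
  have hS : insert j (S \ {j}) = S := Set.insert_sdiff_self_of_mem (V.mem_span_image.1 hx hxj')
  have hV : V '' S = insert (V j) (V '' (S \ {j})) := by rw [← Set.image_insert_eq, hS]
  have hupdate : Function.update V j x '' S = insert x (V '' (S \ {j})) := by
    have := Set.image_insert_eq (f := Function.update V j x) (a := j) (s := S \ {j})
    rwa [hS, Function.update_self, hrest] at this
  rw [hV] at hx
  rw [hV, hupdate, Submodule.span_le, Set.insert_subset_iff]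
  have hxrest : x ∉ Submodule.span K (V '' (S \ {j})) := fun h ↦
    (V.mem_span_image.1 h hxj').2 rfl
  exact ⟨mem_span_insert_exchange hx hxrest, (Set.subset_insert _ _).trans Submodule.subset_span⟩

end GenericVector

section Spectrum

variable {ι κ : Type*}

/-- The coordinates of a real vector together with a tuple of complex vectors. -/
def graphCoords (y : (κ → ℝ) × (ι → κ → ℂ)) : κ ⊕ ((ι × κ) ⊕ (ι × κ)) → ℝ :=
  Sum.elim y.1 (tupleCoords y.2)

theorem zariskiDense_graphCoords :
    ZariskiDense (graphCoords : (κ → ℝ) × (ι → κ → ℂ) → κ ⊕ ((ι × κ) ⊕ (ι × κ)) → ℝ) := by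
  refine zariskiDense_of_surjective fun z ↦ ?_
  obtain ⟨W, hW⟩ := tupleCoords_surjective fun t ↦ z (.inr t)
  exact ⟨(fun k ↦ z (.inl k), W), funext (Sum.rec (fun _ ↦ rfl) (congrFun hW))⟩

/-- The parameters of a graph point: a tuple `W` together with a linear combination of it, the
coefficients `b` of which are normalized by a phase at `j₀`. -/
structure CombinationParam (ι κ : Type*) (j₀ : ι) where
  b : ι → ℂ
  W : ι → κ → ℂ
  im_b_eq_zero : (b j₀).im = 0

namespace CombinationParam

variable {j₀ : ι}

/-- The real coordinates of a `CombinationParam` that are not fixed by its constraint. -/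
def coords (θ : CombinationParam ι κ j₀) :
    (ι ⊕ {j // j ≠ j₀}) ⊕ ((ι × κ) ⊕ (ι × κ)) → ℝ :=
  Sum.elim (Sum.elim (fun j ↦ (θ.b j).re) (fun j ↦ (θ.b j).im)) (tupleCoords θ.W)

theorem b_mem (j : ι) :
    (fun θ : CombinationParam ι κ j₀ ↦ θ.b j) ∈ complexPolyFun coords := by
  refine ⟨coord_mem_polyFun coords (.inl (.inl j)), ?_⟩
  rcases eq_or_ne j j₀ with rfl | hne
  · simpa only [im_b_eq_zero] using const_mem_polyFun coords 0
  · exact coord_mem_polyFun coords (.inl (.inr ⟨j, hne⟩))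

end CombinationParam

theorem exists_polyFun_graphCoords_eq_zero [Fintype ι] [Fintype κ] [Nonempty ι]
    (hcard : 2 * Fintype.card ι < Fintype.card κ + 1) :
    ∃ f ∈ polyFun (graphCoords : (κ → ℝ) × (ι → κ → ℂ) → κ ⊕ ((ι × κ) ⊕ (ι × κ)) → ℝ), f ≠ 0 ∧
      ∀ (W : ι → κ → ℂ) (a : ι → ℂ), f (fun k ↦ ‖(a ᵥ* of W) k‖ ^ 2, W) = 0 := by
  classical
  obtain ⟨j₀⟩ := ‹Nonempty ι›
  let Φ (θ : CombinationParam ι κ j₀) : (κ → ℝ) × (ι → κ → ℂ) :=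
    (fun k ↦ ‖(θ.b ᵥ* of θ.W) k‖ ^ 2, θ.W)
  have hΦ (t) : (fun θ ↦ graphCoords (Φ θ) t) ∈ polyFun CombinationParam.coords := by
    rcases t with k | t
    · exact norm_sq_mem_polyFun (sum_mul_mem_complexPolyFun Finset.univ
        (fun j _ ↦ CombinationParam.b_mem j) fun j _ ↦
          ⟨coord_mem_polyFun CombinationParam.coords (.inr (.inl (j, k))),
            coord_mem_polyFun CombinationParam.coords (.inr (.inr (j, k)))⟩)
    · exact coord_mem_polyFun CombinationParam.coords (.inr t)
  obtain ⟨f, hf, hf₀, hfΦ⟩ := exists_polyFun_comp_eq_zero zariskiDense_graphCoords hΦ <| by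
    have hpos : 0 < Fintype.card ι := Fintype.card_pos_iff.2 ⟨j₀⟩
    simp only [Fintype.card_sum, Fintype.card_subtype_compl, Fintype.card_unique]
    omega
  refine ⟨f, hf, hf₀, fun W a ↦ ?_⟩
  obtain ⟨s, hs, hsa⟩ := Complex.exists_norm_eq_mul_self (a j₀)
  simpa [Φ, smul_vecMul, hs] using hfΦ ⟨s • a, W, by simp [← hsa]⟩

theorem HoldsGenerically.of_graphCoords {S : Finset ι} {j : ι} (hj : j ∉ S)
    {Q : (κ → ℝ) × (S → κ → ℂ) → Prop} (h : HoldsGenerically graphCoords Q) :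
    HoldsGenerically tupleCoords fun v : ι → κ → ℂ ↦ Q (fun k ↦ ‖v j k‖ ^ 2, fun i ↦ v i) := by
  classical
  refine h.comp (Φ := fun v : ι → κ → ℂ ↦ (fun k ↦ ‖v j k‖ ^ 2, fun i : S ↦ v i)) ?_ ?_
  · rintro (k | t)
    · exact norm_sq_mem_polyFun (entry_mem_complexPolyFun j k)
    · exact realCoords_mem_polyFun (z := fun (v : ι → κ → ℂ) (q : S × κ) ↦ v q.1 q.2)
        (fun q ↦ entry_mem_complexPolyFun q.1.1 q.2) t
  · refine zariskiDense_of_pi_subset_range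
      (I := Sum.elim (fun _ ↦ Set.Ici 0) fun _ ↦ Set.univ) ?_ fun z hz ↦ ?_
    · rintro (_ | _)
      exacts [Set.Ici_infinite 0, Set.infinite_univ]
    · obtain ⟨W, hW⟩ := tupleCoords_surjective fun t ↦ z (.inr t)
      refine ⟨fun i k ↦ if hi : i ∈ S then W ⟨i, hi⟩ k else √(z (.inl k)), ?_⟩
      ext (k | t)
      · simpa [graphCoords, hj] using Real.sq_sqrt (hz (.inl k) trivial)
      · simpa [graphCoords] using congrFun hW t

theorem holdsGenerically_exists_separating [Fintype κ] {S : Finset ι} {j : ι}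
    (hS : S.Nonempty) (hj : j ∉ S) (hcard : 2 * S.card < Fintype.card κ + 1) :
    HoldsGenerically tupleCoords fun v : ι → κ → ℂ ↦ ∃ p : MvPolynomial κ ℝ,
      (∀ y ∈ Submodule.span ℂ (v '' S), eval (fun k ↦ ‖y k‖ ^ 2) p = 0) ∧
        eval (fun k ↦ ‖v j k‖ ^ 2) p ≠ 0 := by
  have : Nonempty S := hS.to_subtype
  obtain ⟨f, hf, hf₀, hfS⟩ := exists_polyFun_graphCoords_eq_zero (ι := S) (κ := κ)
    (by rwa [Fintype.card_coe])
  have hgen := holdsGenerically_iff.2 ⟨f, hf, hf₀, fun _ h ↦ h⟩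
  refine (hgen.of_graphCoords hj).mono fun v hv ↦ ?_
  have hfiber : (fun u : κ → ℝ ↦ f (u, fun i ↦ v i)) ∈ polyFun (id : (κ → ℝ) → κ → ℝ) := by
    refine comp_mem_polyFun (Φ := fun u ↦ (u, fun i : S ↦ v i)) (fun t ↦ ?_) hf
    rcases t with k | t
    · exact coord_mem_polyFun id k
    · exact const_mem_polyFun id (tupleCoords (fun i : S ↦ v i) t)
  obtain ⟨p, hp⟩ := mem_polyFun_iff.1 hfiber
  refine ⟨p, fun y hy ↦ ?_, fun h ↦ hv ((hp _).trans h)⟩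
  rw [Set.image_eq_range, Submodule.mem_span_range_iff_exists_fun] at hy
  obtain ⟨a, rfl⟩ := hy
  have hfa := hfS (fun i ↦ v i) a
  rw [vecMul_eq_sum] at hfa
  exact (hp _).symm.trans hfa

end Spectrum

section Fourier

variable {N : ℕ}

theorem isUnit_dftMatrix (N : ℕ) : IsUnit (dftMatrix N) := by
  rw [Matrix.isUnit_iff_isUnit_det, isUnit_iff_ne_zero]
  rcases Nat.eq_zero_or_pos N with rfl | hN
  · simp
  set ω := Complex.exp (-2 * Real.pi * Complex.I / N) with hω
  have hprim : IsPrimitiveRoot ω N := by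
    have h := (Complex.isPrimitiveRoot_exp N hN.ne').inv
    rwa [← Complex.exp_neg, show -(2 * (Real.pi : ℂ) * Complex.I / N)
      = -2 * Real.pi * Complex.I / N by ring] at h
  have hF : dftMatrix N = Matrix.vandermonde fun j : Fin N ↦ ω ^ (j : ℕ) := by
    ext j k
    simp [dftMatrix, Matrix.vandermonde_apply, hω, pow_mul]
  rw [hF, Matrix.det_vandermonde_ne_zero_iff]
  exact fun i j hij ↦ Fin.ext (hprim.pow_inj i.2 j.2 hij)

theorem dftMatrix_mulVec_injective (N : ℕ) : Function.Injective (dftMatrix N).mulVec :=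
  Matrix.mulVec_injective_of_isUnit (isUnit_dftMatrix N)

theorem dftMatrix_mulVec_ne_zero {x : Fin N → ℂ} (hx : x ≠ 0) : dftMatrix N *ᵥ x ≠ 0 :=
  fun h ↦ hx (dftMatrix_mulVec_injective N (h.trans (mulVec_zero _).symm))

theorem eqUpToPhase_of_dft {x y : Fin N → ℂ}
    (h : ∃ t : ℂ, ‖t‖ = 1 ∧ dftMatrix N *ᵥ x = t • (dftMatrix N *ᵥ y)) : EqUpToPhase x y := by
  obtain ⟨t, ht, h⟩ := h
  exact ⟨t, ht, dftMatrix_mulVec_injective N (h.trans (mulVec_smul _ t y).symm)⟩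

theorem EqUpToPhase.powerSpectrum_eq {x y : Fin N → ℂ} (h : EqUpToPhase x y) :
    powerSpectrum x = powerSpectrum y := by
  obtain ⟨t, ht, rfl⟩ := h
  ext k
  simp [powerSpectrum, mulVec_smul, ht]

theorem powerSpectrum_eq_iff {x y : Fin N → ℂ} :
    powerSpectrum x = powerSpectrum y ↔
      ∀ k, ‖(dftMatrix N *ᵥ x) k‖ = ‖(dftMatrix N *ᵥ y) k‖ := by
  simp [powerSpectrum, funext_iff]

theorem eq_zero_of_powerSpectrum_eq {x : Fin N → ℂ} (h : powerSpectrum x = powerSpectrum 0) :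
    x = 0 := by
  refine dftMatrix_mulVec_injective N (funext fun k ↦ ?_)
  simpa using powerSpectrum_eq_iff.1 h k

theorem mulVec_mem_span_image {m n ι : Type*} [Fintype n] (A : Matrix m n ℂ) {v : ι → n → ℂ}
    {S : Set ι} {x : n → ℂ} (hx : x ∈ Submodule.span ℂ (v '' S)) :
    A *ᵥ x ∈ Submodule.span ℂ ((fun i ↦ A *ᵥ v i) '' S) := by
  have := Submodule.mem_map_of_mem (f := A.mulVecLin) hx
  rwa [Submodule.map_span, ← Set.image_comp] at this

theorem HoldsGenerically.dft {Q : (Fin N → Fin N → ℂ) → Prop}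
    (h : HoldsGenerically tupleCoords Q) :
    HoldsGenerically basisCoords fun V : OrderedBasis N ↦ Q fun i ↦ dftMatrix N *ᵥ V i := by
  refine (h.comp (Φ := fun v i ↦ dftMatrix N *ᵥ v i) (fun t ↦ ?_)
    (zariskiDense_of_surjective ?_)).of_tupleCoords
  · exact realCoords_mem_polyFun (fun q ↦ sum_mul_mem_complexPolyFun Finset.univ
      (fun k _ ↦ const_mem_complexPolyFun tupleCoords (dftMatrix N q.2 k))
      fun k _ ↦ entry_mem_complexPolyFun q.1 k) t
  · exact tupleCoords_surjective.comp
      (mulVec_surjective_iff_isUnit.2 (isUnit_dftMatrix N)).comp_left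

theorem holdsGenerically_eqUpToPhase {M : ℕ} (h : 4 * M < N + 3) :
    HoldsGenerically basisCoords fun V : OrderedBasis N ↦ ∀ S₁ S₂ : Finset (Fin N),
      S₁.card = M → S₂.card = M → ∀ x ∈ sparseSpan V S₁, ∀ y ∈ sparseSpan V S₂,
        powerSpectrum x = powerSpectrum y → EqUpToPhase x y := by
  refine holdsGenerically_forall (zariskiDense_basisCoords N) fun S₁ ↦
    holdsGenerically_forall (zariskiDense_basisCoords N) fun S₂ ↦
      holdsGenerically_forall (zariskiDense_basisCoords N) fun hS₁ ↦
        holdsGenerically_forall (zariskiDense_basisCoords N) fun hS₂ ↦ ?_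
  have hcard : 2 * S₁.card + 2 * S₂.card < Fintype.card (Fin N) + 3 := by
    rw [hS₁, hS₂, Fintype.card_fin]
    omega
  refine (holdsGenerically_eq_smul_of_norm_eq hcard).dft.mono fun V hV x hx y hy hxy ↦ ?_
  rcases eq_or_ne x 0 with rfl | hx₀
  · exact ⟨1, norm_one, by rw [eq_zero_of_powerSpectrum_eq hxy.symm, smul_zero]⟩
  · exact eqUpToPhase_of_dft (hV _ (mulVec_mem_span_image _ hx) (dftMatrix_mulVec_ne_zero hx₀) _
      (mulVec_mem_span_image _ hy) (powerSpectrum_eq_iff.1 hxy))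

theorem holdsGenerically_sparseSpan {V : OrderedBasis N} {S : Finset (Fin N)} {j : Fin N}
    (hj : j ∈ S) {g : (Fin N → ℂ) → ℝ} (hg : g ∈ polyFun realCoords)
    (hgj : g (dftMatrix N *ᵥ V j) ≠ 0) :
    HoldsGenerically (fun x : sparseSpan V S ↦ realCoords (x : Fin N → ℂ)) fun x ↦
      g (dftMatrix N *ᵥ (x : Fin N → ℂ)) ≠ 0 ∧ V.repr x j ≠ 0 := by
  have hlin (φ : (Fin N → ℂ) →ₗ[ℂ] ℂ) : (fun x : sparseSpan V S ↦ φ x) ∈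
      complexPolyFun fun x : sparseSpan V S ↦ realCoords (x : Fin N → ℂ) :=
    linearMap_apply_mem_complexPolyFun
      (fun k ↦ ⟨coord_mem_polyFun _ (Sum.inl k), coord_mem_polyFun _ (Sum.inr k)⟩) φ
  have hgF := comp_mem_polyFun (fun t ↦ realCoords_mem_polyFun
    (fun k ↦ hlin (LinearMap.proj k ∘ₗ (dftMatrix N).mulVecLin)) t) hg
  refine holdsGenerically_iff.2 ⟨_, mul_mem hgF (norm_sq_mem_polyFun (hlin (V.coord j))),
    fun h ↦ hgj ?_, fun x hx ↦ ⟨left_ne_zero_of_mul hx, fun h ↦ right_ne_zero_of_mul hx ?_⟩⟩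
  · simpa using congrFun h ⟨V j, Submodule.subset_span ⟨j, hj, rfl⟩⟩
  · simp [h]

theorem holdsGenerically_sr1g {M : ℕ} (h : 2 * M < N + 1) :
    HoldsGenerically basisCoords (SR1g M : OrderedBasis N → Prop) := by
  refine holdsGenerically_forall (zariskiDense_basisCoords N) fun S ↦
    holdsGenerically_forall (zariskiDense_basisCoords N) fun hS ↦ ?_
  rcases S.eq_empty_or_nonempty with rfl | ⟨j, hj⟩
  · have : Nonempty (OrderedBasis N) := ⟨Pi.basisFun ℂ (Fin N)⟩
    refine holdsGenerically_of_forall fun V ↦ holdsGenerically_of_forall fun x y hy ↦ ?_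
    have hbot : sparseSpan V ∅ = ⊥ := by simp [sparseSpan]
    have hxy : (x : Fin N → ℂ) = y :=
      ((Submodule.eq_bot_iff _).1 hbot x x.2).trans ((Submodule.eq_bot_iff _).1 hbot y hy).symm
    exact ⟨fun _ ↦ ⟨1, norm_one, by rw [hxy, one_smul]⟩, EqUpToPhase.powerSpectrum_eq⟩
  have hcard : 2 * ({j} : Finset (Fin N)).card + 2 * S.card < Fintype.card (Fin N) + 3 := by
    rw [hS, Fintype.card_fin, Finset.card_singleton]
    omega
  refine ((holdsGenerically_eq_smul_of_norm_eq hcard).exists_update j).dft.mono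
    fun V ⟨g, hg, hgj, hV⟩ ↦ (holdsGenerically_sparseSpan hj hg hgj).mono
      fun x ⟨hgx, hxj⟩ y hy ↦ ⟨fun hxy ↦ eqUpToPhase_of_dft ?_, EqUpToPhase.powerSpectrum_eq⟩
  have hupdate : Function.update (fun i ↦ dftMatrix N *ᵥ V i) j (dftMatrix N *ᵥ (x : Fin N → ℂ)) =
      fun i ↦ dftMatrix N *ᵥ Function.update V j x i :=
    (Function.comp_update (dftMatrix N).mulVec V j x).symm
  have hx₀ : (x : Fin N → ℂ) ≠ 0 := fun h ↦ hxj (by simp [h])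
  refine hV _ hgx _ (Submodule.subset_span ⟨j, by simp⟩) (dftMatrix_mulVec_ne_zero hx₀) _ ?_
    (powerSpectrum_eq_iff.1 hxy)
  rw [hupdate]
  exact mulVec_mem_span_image _ (span_image_le_span_update_image V x.2 hxj hy)

theorem holdsGenerically_sr2g {M : ℕ} (h : 2 * M < N + 1) :
    HoldsGenerically basisCoords (SR2g M : OrderedBasis N → Prop) := by
  refine holdsGenerically_forall (zariskiDense_basisCoords N) fun S₁ ↦
    holdsGenerically_forall (zariskiDense_basisCoords N) fun S₂ ↦
      holdsGenerically_forall (zariskiDense_basisCoords N) fun hne ↦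
        holdsGenerically_forall (zariskiDense_basisCoords N) fun hS₁ ↦
          holdsGenerically_forall (zariskiDense_basisCoords N) fun hS₂ ↦ ?_
  obtain ⟨j, hj₁, hj₂⟩ : ∃ j ∈ S₁, j ∉ S₂ := Finset.not_subset.1 fun hsub ↦
    hne (Finset.eq_of_subset_of_card_le hsub (hS₂.trans hS₁.symm).le)
  have hS₂ne : S₂.Nonempty := Finset.card_pos.1 (hS₂ ▸ hS₁ ▸ Finset.card_pos.2 ⟨j, hj₁⟩)
  have hcard : 2 * S₂.card < Fintype.card (Fin N) + 1 := by
    rwa [hS₂, Fintype.card_fin]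
  refine (holdsGenerically_exists_separating hS₂ne hj₂ hcard).dft.mono fun V ⟨p, hp, hpj⟩ ↦
    ⟨_, isRealAlgebraic_setOf_eval_eq_zero p, ?_, fun hsub ↦ hpj <|
      hsub ⟨V j, Submodule.subset_span ⟨j, hj₁, rfl⟩, rfl⟩⟩
  rintro _ ⟨-, y, hy, rfl⟩
  exact hp _ (mulVec_mem_span_image _ hy)

end Fourier

end PowerSpectrum

theorem mainTheorem2 (N M : ℕ) :
    ((N : ℤ) > 4 * (M : ℤ) - 3 →
      PowerSpectrum.HoldsGenerically PowerSpectrum.basisCoords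
        (fun V : PowerSpectrum.OrderedBasis N =>
          PowerSpectrum.SR1 M V ∧ PowerSpectrum.SR2 M V)) ∧
    ((N : ℤ) > 2 * (M : ℤ) - 1 →
      PowerSpectrum.HoldsGenerically PowerSpectrum.basisCoords
        (fun V : PowerSpectrum.OrderedBasis N =>
          PowerSpectrum.SR1g M V ∧ PowerSpectrum.SR2g M V)) := by
  refine ⟨fun h ↦ ?_, fun h ↦ ?_⟩
  · refine (PowerSpectrum.holdsGenerically_eqUpToPhase (by omega)).mono fun V hphase ↦
      ⟨fun S hS x hx y hy ↦
        ⟨hphase S S hS hS x hx y hy, PowerSpectrum.EqUpToPhase.powerSpectrum_eq⟩,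
      fun S₁ S₂ _ hS₁ hS₂ ↦ Set.Subset.antisymm ?_ (Set.image_inter_subset _ _ _)⟩
    rintro _ ⟨⟨x, hx, rfl⟩, y, hy, hxy⟩
    obtain ⟨t, -, rfl⟩ := hphase S₁ S₂ hS₁ hS₂ x hx y hy hxy.symm
    exact ⟨t • y, ⟨hx, Submodule.smul_mem _ t hy⟩, rfl⟩
  · exact (PowerSpectrum.holdsGenerically_sr1g (by omega)).and
      (PowerSpectrum.zariskiDense_basisCoords N) (PowerSpectrum.holdsGenerically_sr2g (by omega))
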